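/- **Theorem.** A clutter $\mathcal{C}$ over a finite ground set $V$ is a family of subsets of $V$, called members, none of which contains another. A cover is a subset of $V$ that meets every member; the covering number $\tau(\mathcal{C})$ is the minimum cardinality of a cover, and a minimum cover is a cover of that cardinality. The clutter $\mathcal{C}$ is ideal if for every $w\in\mathbb{Z}_{\ge 0}^V$ the linear program $$\min\Big\{w^\top x \;:\; \sum_{u\in C}x_u\ge 1\ \ \forall C\in\mathcal{C},\ \ x\in\mathbb{R}^V,\ x\ge 0\Big\}$$ has an integral optimal solution. It is tangled if $\tau(\mathcal{C})=2$ and every element of $V$ belongs to a minimum cover. For $n\ge 1$ and $S\subseteq\{0,1\}^n$, the cuboid of $S$ is the clutter over $\{1,\dots,2n\}$ whose members have incidence vectors $(p_1,1-p_1,\dots,p_n,1-p_n)$, $p\in S$; a clutter is called a cuboid if it equals the cuboid of some such $S$ after a relabeling of its ground set. To duplicate an element $u$ of a clutter is to add a new element $\bar u$ to the ground set and to replace each member $C$ containing $u$ by $C\cup\{\bar u\}$, leaving the other members unchanged; a duplication of a clutter is a clutter obtained from it by duplicating elements repeatedly (possibly zero times), up to relabeling the elements. Let $\mathcal{C}$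 be an ideal tangled clutter over a finite ground set $V$, and let its core be the clutter over $V$ $$\mathrm{core}(\mathcal{C})=\{C\in\mathcal{C} : |C\cap B|=1 \text{ for every minimum cover } B \text{ of } \mathcal{C}\}.$$ Then $\mathrm{core}(\mathcal{C})$ is a duplication of a cuboid. Moreover, $\mathrm{core}(\mathcal{C})$ is an ideal tangled clutter. -/

import Mathlib

universe u v

/-- A clutter over the ground set `V`: a family of finite subsets of `V`, the members, none of
which contains another one. -/
@[ext]
structure Clutter (V : Type u) where
  members : Set (Finset V)
  antichain : IsAntichain (· ⊆ ·) members

namespace Clutter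

/-- A cover is a set of elements that meets every member. -/
def IsCover {V : Type u} (C : Clutter V) (B : Finset V) : Prop :=
  ∀ A ∈ C.members, ∃ a, a ∈ B ∧ a ∈ A

/-- The covering number `τ(C)`, the minimum cardinality of a cover (`⊤` if there is no cover,
which happens only if `∅` is a member). -/
noncomputable def coveringNumber {V : Type u} (C : Clutter V) : ℕ∞ :=
  ⨅ (B : Finset V) (_ : C.IsCover B), (B.card : ℕ∞)

/-- A minimum cover is a cover of minimum cardinality. -/
def IsMinimumCover {V : Type u} (C : Clutter V) (B : Finset V) : Prop :=
  C.IsCover B ∧ (B.card : ℕ∞) = C.coveringNumber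

/-- A clutter is tangled if it has covering number two and every element belongs to a
minimum cover. -/
def IsTangled {V : Type u} (C : Clutter V) : Prop :=
  C.coveringNumber = 2 ∧ ∀ a : V, ∃ B : Finset V, C.IsMinimumCover B ∧ a ∈ B

/-- Feasible solutions of the fractional covering problem:
`x ≥ 0` and `∑ (x a : a ∈ A) ≥ 1` for every member `A`. -/
def IsFractionalCover {V : Type u} (C : Clutter V) (x : V → ℝ) : Prop :=
  (∀ a, 0 ≤ x a) ∧ ∀ A ∈ C.members, 1 ≤ ∑ a ∈ A, x a

/-- A clutter is ideal if, for every nonnegative integral cost vector `w`, the linear program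
`min {wᵀx : x a fractional cover}` has an integral optimal solution. -/
def IsIdeal {V : Type u} [Fintype V] (C : Clutter V) : Prop :=
  ∀ w : V → ℕ, ∃ z : V → ℤ, C.IsFractionalCover (fun a => (z a : ℝ)) ∧
    ∀ x : V → ℝ, C.IsFractionalCover x → ∑ a, (w a : ℝ) * (z a : ℝ) ≤ ∑ a, (w a : ℝ) * x a

/-- The core of a clutter, over the same ground set: the members that meet every minimum cover
in exactly one element. -/
def core {V : Type u} (C : Clutter V) : Clutter V where
  members := {A | A ∈ C.members ∧ ∀ B, C.IsMinimumCover B → ∃! a, a ∈ A ∧ a ∈ B}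
  antichain := C.antichain.subset fun _ h => h.1

/-- Relabeling the ground set along a bijection. -/
def relabel {V : Type u} {W : Type v} (C : Clutter V) (e : V ≃ W) : Clutter W where
  members := {A | ∃ A' ∈ C.members, A = A'.map e.toEmbedding}
  antichain := by
    rintro _ ⟨A, hA, rfl⟩ _ ⟨B, hB, rfl⟩ hne hsub
    exact C.antichain hA hB (fun h => hne (h ▸ rfl)) (Finset.map_subset_map.1 hsub)

/-- Duplicating the element `a`: the ground set `Option V` is `V` together with the new element
`none`, which is added to exactly those members that contain `a`. -/
def duplicate {V : Type u} (C : Clutter V) (a : V) : Clutter (Option V) where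
  members := {A | ∃ A' ∈ C.members,
    (a ∉ A' ∧ A = A'.map Function.Embedding.some) ∨ (a ∈ A' ∧ A = Finset.insertNone A')}
  antichain := by
    rintro X ⟨A, hA, hX⟩ Y ⟨B, hB, hY⟩ hne hsub
    have hXs : ∀ b, some b ∈ X ↔ b ∈ A := by
      intro b
      rcases hX with ⟨_, rfl⟩ | ⟨_, rfl⟩ <;> simp
    have hYs : ∀ b, some b ∈ Y ↔ b ∈ B := by
      intro b
      rcases hY with ⟨_, rfl⟩ | ⟨_, rfl⟩ <;> simp
    have hAB : A ⊆ B := fun b hb => (hYs b).1 (hsub ((hXs b).2 hb))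
    have hEq : A = B := by
      by_contra h
      exact C.antichain hA hB h hAB
    subst hEq
    apply hne
    rcases hX with ⟨h, rfl⟩ | ⟨h, rfl⟩ <;> rcases hY with ⟨h', rfl⟩ | ⟨h', rfl⟩ <;> first
      | rfl
      | exact absurd h h'
      | exact absurd h' h

/-- `C.HasDuplication D`: the clutter `D` is a duplication of `C`, that is, `D` is obtained from
`C` by repeatedly (possibly zero times) duplicating elements, where the elements may be
relabeled. -/
inductive HasDuplication {V : Type u} (C : Clutter V) : {W : Type u} → Clutter W → Prop
  | refl : HasDuplication C C
  | duplicate {W : Type u} {D : Clutter W} (h : HasDuplication C D) (a : W) :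
      HasDuplication C (D.duplicate a)
  | relabel {W W' : Type u} {D : Clutter W} (h : HasDuplication C D) (e : W ≃ W') :
      HasDuplication C (D.relabel e)

/-- The cuboid of `S ⊆ {0,1}ⁿ`. The ground set `{1, …, 2n}` is written `Fin n × Bool`, where
`(i, true)` and `(i, false)` are the odd and the even element of the `i`-th pair. The member of
a point `p` contains `(i, true)` if `p i = 1` and `(i, false)` if `p i = 0`. -/
def cuboid {n : ℕ} (S : Set (Fin n → Bool)) : Clutter (Fin n × Bool) where
  members := {A | ∃ p ∈ S, A = Finset.univ.filter fun q : Fin n × Bool => p q.1 = q.2}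
  antichain := by
    rintro _ ⟨p, _, rfl⟩ _ ⟨q, _, rfl⟩ hne hsub
    apply hne
    have hpq : p = q := by
      funext i
      have h : (i, p i) ∈ Finset.univ.filter fun r : Fin n × Bool => q r.1 = r.2 :=
        hsub (by simp)
      exact (Finset.mem_filter.1 h).2.symm
    rw [hpq]

/-- A clutter is a cuboid if, after a relabeling of its ground set, it is the cuboid of some
`S ⊆ {0,1}ⁿ` with `n ≥ 1`. -/
def IsCuboid {V : Type u} (C : Clutter V) : Prop :=
  ∃ (n : ℕ) (_ : 1 ≤ n) (S : Set (Fin n → Bool)) (e : V ≃ Fin n × Bool), C.relabel e = cuboid S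

end Clutter

/-! Duality drives everything. In an ideal clutter the least weight of a cover equals the value of
some fractional packing of members, and by complementary slackness (`card_inter_eq_one`) a packing
tight at every minimum cover uses only members of the core. Unit capacities give such a packing of
value two, so the core has no cover of size below two and is tangled. For idealness, a weight is
shrunk to a minimal one with the same least cover weight on the core. Minimality makes it tight at
every minimum cover of `C` (`minimal_weight_pair`), so a packing in `C` is already one in the core.
For the cuboid, each element of the core has a complementary one. Identifying elements that lie in
the same core members leaves complementary pairs, the coordinates of a cuboid; the core is its
pullback, and pullbacks along surjections are duplications. -/

namespace Clutter

/-! ### Linear programming duality -/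

open scoped Classical in
/-- A fractional packing of members of `C` into the capacities `w`. -/
structure IsFractionalPacking {V : Type u} [Fintype V] (C : Clutter V) (w : V → ℝ)
    (y : Finset V → ℝ) : Prop where
  nonneg : ∀ A, 0 ≤ y A
  support : ∀ A, A ∉ C.members → y A = 0
  load_le : ∀ a, ∑ A : Finset V, (if a ∈ A then y A else 0) ≤ w a

open scoped Classical in
/-- Double counting of incidences between elements and weighted sets. -/
theorem sum_mul_load {V : Type u} [Fintype V] (y : Finset V → ℝ) (x : V → ℝ) :
    ∑ a, x a * ∑ A : Finset V, (if a ∈ A then y A else 0) = ∑ A, y A * ∑ a ∈ A, x a := by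
  simp_rw [Finset.mul_sum]
  rw [Finset.sum_comm]
  refine Finset.sum_congr rfl fun A _ => ?_
  simp [mul_ite, Finset.sum_ite_mem, mul_comm]


theorem IsFractionalPacking.sum_le {V : Type u} [Fintype V] {C : Clutter V} {w : V → ℝ}
    {y : Finset V → ℝ} (h : C.IsFractionalPacking w y) {x : V → ℝ} (hx : ∀ a, 0 ≤ x a) :
    ∑ A, y A * ∑ a ∈ A, x a ≤ ∑ a, w a * x a := by
  rw [← sum_mul_load]
  refine Finset.sum_le_sum fun a _ => ?_
  rw [mul_comm (w a)]
  exact mul_le_mul_of_nonneg_left (h.load_le a) (hx a)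

/-- Weak duality. -/
theorem IsFractionalPacking.sum_le_of_isFractionalCover {V : Type u} [Fintype V] {C : Clutter V}
    {w : V → ℝ} {y : Finset V → ℝ} (h : C.IsFractionalPacking w y) {x : V → ℝ}
    (hx : C.IsFractionalCover x) : ∑ A, y A ≤ ∑ a, w a * x a := by
  refine le_trans (Finset.sum_le_sum fun A _ => ?_) (h.sum_le hx.1)
  by_cases hA : A ∈ C.members
  · exact le_mul_of_one_le_right (h.nonneg A) (hx.2 A hA)
  · simp [h.support A hA]

open scoped Classical in
theorem IsCover.isFractionalCover {V : Type u} {C : Clutter V} {B : Finset V} (h : C.IsCover B) :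
    C.IsFractionalCover fun a => if a ∈ B then 1 else 0 := by
  refine ⟨fun a => by positivity, fun A hA => ?_⟩
  obtain ⟨a, haB, haA⟩ := h A hA
  calc (1 : ℝ) = if a ∈ B then 1 else 0 := by simp [haB]
    _ ≤ _ := Finset.single_le_sum (f := fun a => if a ∈ B then (1 : ℝ) else 0)
      (fun a _ => by positivity) haA

/-- An integral fractional cover weighs at least as much as some cover. -/
theorem exists_isCover_sum_le {V : Type u} [Fintype V] {C : Clutter V} (w : V → ℕ) {z : V → ℤ}
    (hz : C.IsFractionalCover fun a => (z a : ℝ)) :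
    ∃ B, C.IsCover B ∧ ((∑ a ∈ B, w a : ℕ) : ℝ) ≤ ∑ a, (w a : ℝ) * z a := by
  classical
  have h0 : ∀ a, 0 ≤ z a := fun a => by
    have : (0 : ℝ) ≤ z a := hz.1 a
    exact_mod_cast this
  refine ⟨Finset.univ.filter fun a => z a ≠ 0, fun A hA => ?_, ?_⟩
  · by_contra! hcon
    have : ∑ a ∈ A, (z a : ℝ) = 0 := Finset.sum_eq_zero fun a ha => by
      by_contra hne
      exact hcon a (by simpa using hne) ha
    linarith [hz.2 A hA]
  · push_cast
    rw [Finset.sum_filter]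
    refine Finset.sum_le_sum fun a _ => ?_
    have := h0 a
    split_ifs with h
    · have h1 : (1 : ℝ) ≤ z a := by exact_mod_cast (by omega : 1 ≤ z a)
      exact le_mul_of_one_le_right (by positivity) h1
    · have h1 : (0 : ℝ) ≤ z a := by exact_mod_cast this
      positivity

open scoped Classical Pointwise in
/-- If the capacities `w` admit no fractional packing of value `t`, then some nonnegative weight
separates `w` from the loads of fractional packings of value `t`. -/
theorem exists_separating_weight {V : Type u} [Fintype V] (C : Clutter V)
    (hne : C.members.Nonempty) (t : ℝ) (ht : 0 ≤ t) (w : V → ℝ)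
    (hno : ¬ ∃ y, C.IsFractionalPacking w y ∧ ∑ A, y A = t) :
    ∃ (g : V → ℝ) (s : ℝ), (∀ a, 0 ≤ g a) ∧ ∑ a, w a * g a < s ∧
      ∀ A ∈ C.members, s < t * ∑ a ∈ A, g a := by
  -- Packings are normalised to total one, so compactness comes from the simplex.
  let Y : Set (Finset V → ℝ) := stdSimplex ℝ (Finset V) ∩ {y | ∀ A, A ∉ C.members → y A = 0}
  have hYconv : Convex ℝ Y := by
    refine (convex_stdSimplex ℝ _).inter ?_
    intro y hy z hz a b _ _ _ A hA
    simp [hy A hA, hz A hA]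
  have hYcomp : IsCompact Y := by
    refine (isCompact_stdSimplex ℝ _).inter_right ?_
    simp only [Set.ofPred_forall]
    refine isClosed_iInter fun A => isClosed_iInter fun _ => ?_
    exact isClosed_eq (continuous_apply A) continuous_const
  let L : (Finset V → ℝ) → V → ℝ := fun y a => ∑ A, if a ∈ A then t * y A else 0
  have hLlin : IsLinearMap ℝ L := by
    constructor
    · intro y z
      funext a
      simp only [L, Pi.add_apply, ← Finset.sum_add_distrib]
      refine Finset.sum_congr rfl fun A _ => ?_
      split_ifs <;> ring
    · intro c y
      funext a
      simp only [L, Pi.smul_apply, smul_eq_mul, Finset.mul_sum]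
      refine Finset.sum_congr rfl fun A _ => ?_
      split_ifs <;> ring
  have hLcont : Continuous L := by
    refine continuous_pi fun a => continuous_finsetSum _ fun A _ => ?_
    split_ifs <;> fun_prop
  -- The capacities admitting a packing of value `t`: a compact set of loads plus the nonnegative
  -- orthant, hence closed.
  let T : Set (V → ℝ) := L '' Y + Set.Ici 0
  have hTconv : Convex ℝ T := (hYconv.is_linear_image hLlin).add (convex_Ici 0)
  have hTclosed : IsClosed T := isClosed_Ici.add_left_of_isCompact (hYcomp.image hLcont)
  have hwT : w ∉ T := by
    rintro ⟨_, ⟨y, hy, rfl⟩, p, hp, hw⟩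
    refine hno ⟨fun A => t * y A, ⟨fun A => mul_nonneg ht (hy.1.1 A), fun A hA => ?_, fun a => ?_⟩,
      ?_⟩
    · simp [hy.2 A hA]
    · have h1 : L y a + p a = w a := congrFun hw a
      have h2 : 0 ≤ p a := hp a
      simp only [L] at h1
      linarith
    · rw [← Finset.mul_sum, hy.1.2, mul_one]
  obtain ⟨f, s, hfw, hfT⟩ := geometric_hahn_banach_point_closed hTconv hTclosed hwT
  have hf : ∀ x : V → ℝ, f x = ∑ a, x a * f (Pi.single a 1) := fun x => by
    have := LinearMap.pi_apply_eq_sum_univ (f : (V → ℝ) →ₗ[ℝ] ℝ) x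
    simp only [ContinuousLinearMap.coe_coe, smul_eq_mul] at this
    rw [this]
    refine Finset.sum_congr rfl fun a _ => ?_
    congr 2
    funext b
    simp [Pi.single_apply, eq_comm]
  have hmem : ∀ A ∈ C.members, ∀ p : V → ℝ, 0 ≤ p →
      (fun a => if a ∈ A then t else 0) + p ∈ T := by
    intro A hA p hp
    refine Set.add_mem_add ⟨Pi.single A 1, ⟨single_mem_stdSimplex ℝ A, fun A' hA' => ?_⟩, ?_⟩ hp
    · refine Pi.single_eq_of_ne ?_ _
      rintro rfl
      exact hA' hA
    · funext a
      simp only [L]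
      rw [Finset.sum_eq_single A]
      · simp
      · intro A' _ h
        simp [Pi.single_eq_of_ne h]
      · simp
  refine ⟨fun a => f (Pi.single a 1), s, fun a => ?_, by rw [← hf]; exact hfw, fun A hA => ?_⟩
  -- A negative coordinate would let a point of `T` move in that direction until `f` equals `s`.
  · by_contra! hneg
    obtain ⟨A, hA⟩ := hne
    set c := f (fun a => if a ∈ A then t else 0)
    have hc : s < c := by simpa [c] using hfT _ (hmem A hA 0 le_rfl)
    have hp : 0 ≤ ((s - c) / f (Pi.single a 1)) • (Pi.single a 1 : V → ℝ) :=
      smul_nonneg (div_nonneg_of_nonpos (by linarith) hneg.le)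
        (Pi.single_nonneg.2 zero_le_one)
    have h := hfT _ (hmem A hA _ hp)
    rw [map_add, map_smul, smul_eq_mul, div_mul_cancel₀ _ hneg.ne] at h
    linarith
  · have h := hfT _ (hmem A hA 0 le_rfl)
    rw [add_zero, hf] at h
    simpa [Finset.sum_ite_mem, Finset.mul_sum] using h

/-- Strong duality for ideal clutters. -/
theorem IsIdeal.exists_isFractionalPacking {V : Type u} [Fintype V] {C : Clutter V}
    (hC : C.IsIdeal) (w : V → ℕ) (t : ℕ) (hw : ∀ B, C.IsCover B → t ≤ ∑ a ∈ B, w a) :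
    ∃ y, C.IsFractionalPacking (fun a => (w a : ℝ)) y ∧ ∑ A, y A = t := by
  rcases Nat.eq_zero_or_pos t with rfl | ht
  · exact ⟨0, ⟨fun _ => le_rfl, fun _ _ => rfl, fun a => by simp⟩, by simp⟩
  have hne : C.members.Nonempty := by
    by_contra hemp
    have := hw ∅ fun A hA => (hemp ⟨A, hA⟩).elim
    simp at this
    omega
  by_contra hno
  obtain ⟨g, s, hg, hgs, hgA⟩ := C.exists_separating_weight hne t (by positivity) _ hno
  have hs : 0 < s := lt_of_le_of_lt
    (Finset.sum_nonneg fun a _ => mul_nonneg (Nat.cast_nonneg _) (hg a)) hgs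
  have htR : (0 : ℝ) < t := by exact_mod_cast ht
  obtain ⟨z, hz, hopt⟩ := hC w
  obtain ⟨B, hB, hBz⟩ := exists_isCover_sum_le w hz
  -- The scaled weight is a fractional cover costing less than `t`, yet the integral optimum costs
  -- at least `t`.
  have h1 := hopt (fun a => t / s * g a) ⟨fun a => by have := hg a; positivity, fun A hA => by
    rw [← Finset.mul_sum, div_mul_eq_mul_div, le_div_iff₀ hs, one_mul]
    exact (hgA A hA).le⟩
  have h2 : ∑ a, (w a : ℝ) * (t / s * g a) < t := by
    have : ∑ a, (w a : ℝ) * (t / s * g a) = t * (∑ a, (w a : ℝ) * g a) / s := by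
      rw [Finset.mul_sum, Finset.sum_div]
      exact Finset.sum_congr rfl fun a _ => by ring
    rw [this, div_lt_iff₀ hs]
    exact mul_lt_mul_of_pos_left hgs htR
  have h3 : (t : ℝ) ≤ (∑ a ∈ B, w a : ℕ) := by exact_mod_cast hw B hB
  linarith

open scoped Classical in
/-- Complementary slackness. -/
theorem IsFractionalPacking.card_inter_eq_one {V : Type u} [Fintype V] {C : Clutter V}
    {w : V → ℝ} {y : Finset V → ℝ} (h : C.IsFractionalPacking w y) {B : Finset V}
    (hB : C.IsCover B) (hw : ∑ a ∈ B, w a = ∑ A, y A) {A : Finset V} (hA : y A ≠ 0) :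
    (A ∩ B).card = 1 := by
  have h1 := h.sum_le (x := fun a => if a ∈ B then 1 else 0) fun a => by positivity
  simp only [Finset.sum_ite_mem, Finset.sum_const, nsmul_eq_mul, mul_one, mul_ite, mul_zero,
    Finset.univ_inter, hw] at h1
  have hle : ∀ A' ∈ Finset.univ, y A' ≤ y A' * ((A' ∩ B).card : ℝ) := fun A' _ => by
    by_cases hA' : A' ∈ C.members
    · obtain ⟨a, haB, haA⟩ := hB A' hA'
      refine le_mul_of_one_le_right (h.nonneg A') ?_
      exact_mod_cast Finset.card_pos.2 ⟨a, Finset.mem_inter.2 ⟨haA, haB⟩⟩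
    · simp [h.support A' hA']
  have heq := (Finset.sum_eq_sum_iff_of_le hle).1 (le_antisymm (Finset.sum_le_sum hle) h1) A
    (Finset.mem_univ A)
  have : ((A ∩ B).card : ℝ) = 1 := by
    have : y A * (((A ∩ B).card : ℝ) - 1) = 0 := by linarith
    rcases mul_eq_zero.1 this with h | h
    · exact (hA h).elim
    · linarith
  exact_mod_cast this

/-! ### Packings in the core, and its covering number -/

/-- A fractional packing that is tight at all minimum covers is a packing of the core. -/
theorem IsFractionalPacking.core {V : Type u} [Fintype V] {C : Clutter V}
    {w : V → ℝ} {y : Finset V → ℝ} (h : C.IsFractionalPacking w y)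
    (hw : ∀ B, C.IsMinimumCover B → ∑ a ∈ B, w a = ∑ A, y A) :
    C.core.IsFractionalPacking w y := by
  classical
  refine ⟨h.nonneg, fun A hA => ?_, h.load_le⟩
  by_contra hne
  refine hA ⟨by_contra fun hA' => hne (h.support A hA'), fun B hB => ?_⟩
  obtain ⟨a, ha⟩ := Finset.card_eq_one.1 (h.card_inter_eq_one hB.1 (hw B hB) hne)
  refine ⟨a, ?_, fun b hb => ?_⟩
  · simpa [ha] using (Finset.mem_inter (a := a) (s₁ := A) (s₂ := B)).symm
  · have := Finset.mem_inter.2 hb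
    simpa [ha] using this

theorem IsCover.core {V : Type u} {C : Clutter V} {B : Finset V} (hB : C.IsCover B) :
    C.core.IsCover B := fun A hA => hB A hA.1

theorem IsCover.coveringNumber_le {V : Type u} {C : Clutter V} {B : Finset V} (hB : C.IsCover B) :
    C.coveringNumber ≤ B.card := iInf₂_le B hB

theorem IsTangled.card_eq_two {V : Type u} {C : Clutter V} (hC : C.IsTangled) {B : Finset V}
    (hB : C.IsMinimumCover B) : B.card = 2 := by
  have := hB.2
  rw [hC.1] at this
  exact_mod_cast this

theorem IsTangled.two_le_card {V : Type u} {C : Clutter V} (hC : C.IsTangled) {B : Finset V}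
    (hB : C.IsCover B) : 2 ≤ B.card := by
  have := hB.coveringNumber_le
  rw [hC.1] at this
  exact_mod_cast this

/-- A tangled clutter has a minimum cover. -/
theorem IsTangled.exists_isMinimumCover {V : Type u} {C : Clutter V} (hC : C.IsTangled) :
    ∃ B, C.IsMinimumCover B := by
  by_contra! h
  have hV : IsEmpty V := ⟨fun a => let ⟨B, hB, _⟩ := hC.2 a; h B hB⟩
  -- An empty ground set has no set of size two, hence no cover.
  have htop : C.coveringNumber = ⊤ := by
    refine iInf₂_eq_top.2 fun B hB => ?_
    have := hC.two_le_card hB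
    rw [Finset.eq_empty_of_isEmpty B] at this
    simp at this
  rw [hC.1] at htop
  exact absurd htop (by decide)

/-- The core of an ideal tangled clutter has a fractional packing of value two. -/
theorem IsTangled.exists_isFractionalPacking_core {V : Type u} [Fintype V] {C : Clutter V}
    (hT : C.IsTangled) (hI : C.IsIdeal) :
    ∃ y, C.core.IsFractionalPacking (fun _ => 1) y ∧ ∑ A, y A = 2 := by
  obtain ⟨y, hy, hsum⟩ := hI.exists_isFractionalPacking (fun _ => 1) 2 fun B hB => by
    simpa using hT.two_le_card hB
  simp only [Nat.cast_one, Nat.cast_ofNat] at hy hsum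
  refine ⟨y, hy.core fun B hB => ?_, hsum⟩
  simp [hT.card_eq_two hB, hsum]

theorem IsTangled.two_le_card_of_isCover_core {V : Type u} [Fintype V] {C : Clutter V}
    (hT : C.IsTangled) (hI : C.IsIdeal) {B : Finset V} (hB : C.core.IsCover B) : 2 ≤ B.card := by
  classical
  obtain ⟨y, hy, hsum⟩ := hT.exists_isFractionalPacking_core hI
  have := hy.sum_le_of_isFractionalCover hB.isFractionalCover
  rw [hsum] at this
  simp at this
  exact_mod_cast this

/-- Minimum covers of `C` remain minimum covers of the core, since both covering numbers are two. -/
theorem IsTangled.core {V : Type u} [Fintype V] {C : Clutter V} (hT : C.IsTangled)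
    (hI : C.IsIdeal) : C.core.IsTangled := by
  have h2 : C.core.coveringNumber = 2 := by
    obtain ⟨B, hB⟩ := hT.exists_isMinimumCover
    refine le_antisymm ?_ (le_iInf₂ fun B hB => ?_)
    · simpa [hT.card_eq_two hB] using hB.1.core.coveringNumber_le
    · exact_mod_cast hT.two_le_card_of_isCover_core hI hB
  refine ⟨h2, fun a => ?_⟩
  obtain ⟨B, hB, ha⟩ := hT.2 a
  exact ⟨B, ⟨hB.1.core, by rw [h2, hT.card_eq_two hB]; rfl⟩, ha⟩

/-! ### Minimal weights and idealness of the core -/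

/-- A weight whose covers all weigh at least `t` dominates a minimal such weight. -/
theorem exists_minimal_weight {V : Type u} [Fintype V] (C : Clutter V) (w : V → ℕ) (t : ℕ)
    (hw : ∀ B, C.IsCover B → t ≤ ∑ a ∈ B, w a) :
    ∃ m : V → ℕ, m ≤ w ∧ (∀ B, C.IsCover B → t ≤ ∑ a ∈ B, m a) ∧
      ∀ a, 0 < m a → ∃ B, C.IsCover B ∧ a ∈ B ∧ ∑ b ∈ B, m b = t := by
  classical
  obtain ⟨m, ⟨hmw, hm⟩, hmin⟩ := WellFounded.has_min (wellFounded_lt (α := V → ℕ))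
    {m | m ≤ w ∧ ∀ B, C.IsCover B → t ≤ ∑ a ∈ B, m a} ⟨w, le_rfl, hw⟩
  refine ⟨m, hmw, hm, fun a ha => ?_⟩
  by_contra! hcon
  -- With no tight cover through `a`, lowering `m a` by one keeps all covers at weight at least `t`.
  have hlt : Function.update m a (m a - 1) < m := by
    rw [Pi.lt_def]
    refine ⟨fun b => ?_, a, by simp; omega⟩
    by_cases h : b = a
    · subst h; simp
    · simp [h]
  refine hmin _ ⟨hlt.le.trans hmw, fun B hB => ?_⟩ hlt
  have hB' := hm B hB
  by_cases haB : a ∈ B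
  · rw [Finset.sum_update_of_mem haB]
    have hne := hcon B hB haB
    rw [← Finset.add_sum_erase _ _ haB] at hB' hne
    rw [← Finset.erase_eq]
    omega
  · rwa [Finset.sum_update_of_notMem haB]

/-- Minimal weights are tight at pairs that meet every member exactly once. -/
theorem minimal_weight_pair {V : Type u} (C : Clutter V) {m : V → ℕ} {t : ℕ}
    (hm : ∀ B, C.IsCover B → t ≤ ∑ a ∈ B, m a)
    (hmin : ∀ a, 0 < m a → ∃ B, C.IsCover B ∧ a ∈ B ∧ ∑ b ∈ B, m b = t) {a b : V}
    (hab : ∀ A ∈ C.members, (a ∈ A ↔ b ∉ A)) : m a + m b ≤ t := by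
  classical
  by_contra! hlt
  rcases Nat.eq_zero_or_pos (m a) with ha | ha
  · obtain ⟨B, _, hbB, hBt⟩ := hmin b (by omega)
    have := Finset.single_le_sum (f := m) (fun _ _ => Nat.zero_le _) hbB
    omega
  rcases Nat.eq_zero_or_pos (m b) with hb | hb
  · obtain ⟨B, _, hbB, hBt⟩ := hmin a (by omega)
    have := Finset.single_le_sum (f := m) (fun _ _ => Nat.zero_le _) hbB
    omega
  obtain ⟨B, hB, haB, hBt⟩ := hmin a ha
  obtain ⟨D, hD, hbD, hDt⟩ := hmin b hb
  -- A member containing `a` avoids `b`, so `D` meets it elsewhere; the others avoid `a` and are met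
  -- by `B`. The union weighs at most `2t - m a - m b < t`.
  have hcov : C.IsCover (B.erase a ∪ D.erase b) := by
    intro A hA
    by_cases haA : a ∈ A
    · obtain ⟨c, hc, hcA⟩ := hD A hA
      refine ⟨c, Finset.mem_union_right _ (Finset.mem_erase.2 ⟨?_, hc⟩), hcA⟩
      rintro rfl
      exact (hab A hA).1 haA hcA
    · obtain ⟨c, hc, hcA⟩ := hB A hA
      refine ⟨c, Finset.mem_union_left _ (Finset.mem_erase.2 ⟨?_, hc⟩), hcA⟩
      rintro rfl
      exact haA hcA
  have h1 := hm _ hcov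
  have h2 : ∑ c ∈ B.erase a ∪ D.erase b, m c ≤ ∑ c ∈ B.erase a, m c + ∑ c ∈ D.erase b, m c := by
    rw [← Finset.sum_union_inter]
    exact Nat.le_add_right _ _
  have h3 := Finset.add_sum_erase B m haB
  have h4 := Finset.add_sum_erase D m hbD
  omega

/-- A minimum cover of a tangled clutter is a pair of elements, exactly one of which lies in
each member of the core. -/
theorem IsTangled.exists_pair {V : Type u} {C : Clutter V} (hT : C.IsTangled) {B : Finset V}
    (hB : C.IsMinimumCover B) {a : V} (ha : a ∈ B) :
    ∃ b, a ≠ b ∧ (∀ c, c ∈ B ↔ c = a ∨ c = b) ∧ ∀ A ∈ C.core.members, (a ∈ A ↔ b ∉ A) := by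
  classical
  obtain ⟨b, hb⟩ := Finset.card_eq_one.1
    (by rw [Finset.card_erase_of_mem ha, hT.card_eq_two hB] : (B.erase a).card = 1)
  have hba : b ≠ a ∧ b ∈ B := Finset.mem_erase.1 (hb ▸ Finset.mem_singleton_self b)
  refine ⟨b, hba.1.symm, fun c => ?_, fun A hA => ?_⟩
  · have := Finset.ext_iff.1 hb c
    simp only [Finset.mem_erase, Finset.mem_singleton] at this
    by_cases hca : c = a
    · simp [hca, ha]
    · simpa [hca] using this
  · obtain ⟨c, ⟨hcA, hcB⟩, huniq⟩ := hA.2 B hB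
    constructor
    · intro haA hbA
      exact hba.1 ((huniq b ⟨hbA, hba.2⟩).trans (huniq a ⟨haA, ha⟩).symm)
    · intro hbA
      have := Finset.ext_iff.1 hb c
      simp only [Finset.mem_erase, Finset.mem_singleton, hcB, and_true] at this
      by_contra haA
      have hca : c ≠ a := fun h => haA (h ▸ hcA)
      exact hbA (this.1 hca ▸ hcA)

theorem IsIdeal.core {V : Type u} [Fintype V] {C : Clutter V} (hI : C.IsIdeal)
    (hT : C.IsTangled) : C.core.IsIdeal := by
  classical
  intro w
  obtain ⟨B₀, hB₀⟩ := hT.exists_isMinimumCover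
  obtain ⟨B, hB, hBmin⟩ := Finset.exists_min_image
    (Finset.univ.filter fun B => C.core.IsCover B) (fun B => ∑ a ∈ B, w a)
    ⟨B₀, by simpa using hB₀.1.core⟩
  simp only [Finset.mem_filter, Finset.mem_univ, true_and] at hB hBmin
  refine ⟨fun a => if a ∈ B then 1 else 0, by simpa using hB.isFractionalCover, fun x hx => ?_⟩
  obtain ⟨m, hmw, hm, hmin⟩ := C.core.exists_minimal_weight w _ hBmin
  -- Covers of `C` also cover the core, so the bound on `m` passes to `C`.
  obtain ⟨y, hy, hsum⟩ := hI.exists_isFractionalPacking m _ fun D hD => hm D hD.core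
  have hcore : C.core.IsFractionalPacking (fun a => (m a : ℝ)) y := by
    refine hy.core fun D hD => ?_
    rw [hsum]
    norm_cast
    refine le_antisymm ?_ (hm D hD.1.core)
    obtain ⟨a, ha⟩ := Finset.card_pos.1 (by rw [hT.card_eq_two hD]; norm_num : 0 < D.card)
    obtain ⟨b, hab, hDab, hpair⟩ := hT.exists_pair hD ha
    have hD' : D = {a, b} := by ext c; simp [hDab]
    rw [hD', Finset.sum_pair hab]
    exact C.core.minimal_weight_pair hm hmin hpair
  calc ∑ a, (w a : ℝ) * ((if a ∈ B then 1 else 0 : ℤ) : ℝ) = ∑ A, y A := by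
        rw [hsum]; simp
    _ ≤ ∑ a, (m a : ℝ) * x a := hcore.sum_le_of_isFractionalCover hx
    _ ≤ ∑ a, (w a : ℝ) * x a := Finset.sum_le_sum fun a _ =>
        mul_le_mul_of_nonneg_right (by exact_mod_cast hmw a) (hx.1 a)

/-! ### Pullbacks as duplications -/

/-- The pullback of a clutter along a surjection, whose members are the preimages of members. -/
def comap {V : Type u} {W : Type v} (D : Clutter W) (f : V → W) (hf : f.Surjective) :
    Clutter V where
  members := {A | ∃ A' ∈ D.members, ∀ a, a ∈ A ↔ f a ∈ A'}
  antichain := by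
    rintro A ⟨A', hA', hA⟩ B ⟨B', hB', hB⟩ hne hsub
    have hAB : A' = B' := by
      by_contra h
      refine D.antichain hA' hB' h fun c hc => ?_
      obtain ⟨a, rfl⟩ := hf c
      exact (hB a).1 (hsub ((hA a).2 hc))
    subst hAB
    exact hne (Finset.ext fun a => (hA a).trans (hB a).symm)

/-- A pullback along a bijection is a relabeling. -/
theorem relabel_eq_comap {V : Type u} {W : Type v} (D : Clutter W) (e : W ≃ V) :
    D.relabel e = D.comap e.symm e.symm.surjective := by
  ext A
  constructor
  · rintro ⟨A', hA', rfl⟩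
    exact ⟨A', hA', fun a => by simp [Finset.mem_map_equiv]⟩
  · rintro ⟨A', hA', h⟩
    exact ⟨A', hA', Finset.ext fun a => by simp [h, Finset.mem_map_equiv]⟩

/-- A pullback is obtained from a pullback that omits an element `b` by duplicating an element of
the same fibre. -/
theorem comap_eq_relabel_duplicate {V : Type u} {W : Type v} [DecidableEq V]
    (D : Clutter W) (f : V → W) (hf : f.Surjective) {a b : V} (hab : a ≠ b) (hfab : f a = f b)
    (hf' : (fun c : {c // c ≠ b} => f c).Surjective) :
    ((D.comap (fun c : {c // c ≠ b} => f c) hf').duplicate ⟨a, hab⟩).relabel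
      (Equiv.optionSubtypeNe b) = D.comap f hf := by
  rw [relabel_eq_comap]
  ext A
  constructor
  · rintro ⟨X, ⟨X', ⟨A', hA', hX'⟩, hX⟩, hA⟩
    refine ⟨A', hA', fun c => ?_⟩
    rw [hA]
    by_cases hc : c = b
    · subst hc
      rw [← hfab, ← hX' ⟨a, hab⟩]
      rcases hX with ⟨h, rfl⟩ | ⟨h, rfl⟩ <;> simp [h]
    · rw [← hX' ⟨c, hc⟩, Equiv.optionSubtypeNe_symm_of_ne hc]
      rcases hX with ⟨h, rfl⟩ | ⟨h, rfl⟩ <;> simp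
  · rintro ⟨A', hA', hA⟩
    have hX' : A.subtype (fun c => c ≠ b) ∈ (D.comap (fun c : {c // c ≠ b} => f c) hf').members :=
      ⟨A', hA', fun c => by simp [hA]⟩
    by_cases haA : a ∈ A
    · refine ⟨_, ⟨_, hX', Or.inr ⟨by simpa using haA, rfl⟩⟩, fun c => ?_⟩
      by_cases hc : c = b
      · subst hc
        simpa [hA, ← hfab] using (hA a).1 haA
      · simp [Equiv.optionSubtypeNe_symm_of_ne hc]
    · refine ⟨_, ⟨_, hX', Or.inl ⟨by simpa using haA, rfl⟩⟩, fun c => ?_⟩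
      by_cases hc : c = b
      · subst hc
        simpa [hA, ← hfab] using fun h => haA ((hA a).2 h)
      · simp [Equiv.optionSubtypeNe_symm_of_ne hc]

/-- Every pullback of a clutter along a surjection of finite sets is a duplication of it. -/
theorem hasDuplication_comap {W : Type u} (D : Clutter W) {V : Type u} [Finite V] (f : V → W)
    (hf : f.Surjective) : D.HasDuplication (D.comap f hf) := by
  classical
  induction hn : Nat.card V generalizing V with
  | zero =>
    have hV : IsEmpty V := (Nat.card_eq_zero.1 hn).resolve_right (not_infinite_iff_finite.2 ‹_›)
    let e : W ≃ V := (Equiv.ofBijective f ⟨fun a => isEmptyElim a, hf⟩).symm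
    have : D.comap f hf = D.relabel e := by rw [relabel_eq_comap]; rfl
    rw [this]
    exact HasDuplication.refl.relabel e
  | succ n ih =>
    by_cases hinj : f.Injective
    · let e : W ≃ V := (Equiv.ofBijective f ⟨hinj, hf⟩).symm
      have : D.comap f hf = D.relabel e := by rw [relabel_eq_comap]; rfl
      rw [this]
      exact HasDuplication.refl.relabel e
    · simp only [Function.Injective, not_forall] at hinj
      obtain ⟨a, b, hfab, hab⟩ := hinj
      have hf' : (fun c : {c // c ≠ b} => f c).Surjective := fun w => by
        obtain ⟨c, rfl⟩ := hf w
        by_cases hc : c = b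
        · exact ⟨⟨a, hab⟩, by rw [hc]; exact hfab⟩
        · exact ⟨⟨c, hc⟩, rfl⟩
      rw [← comap_eq_relabel_duplicate D f hf hab hfab hf']
      refine ((ih _ hf' ?_).duplicate _).relabel _
      have := Nat.card_congr (Equiv.optionSubtypeNe b)
      rw [Finite.card_option] at this
      omega

/-! ### Parallel classes and cuboids -/

/-- Two elements are parallel if they lie in the same members, or in complementary sets of
members. -/
def parallelSetoid {V : Type u} (E : Clutter V) : Setoid V where
  r a b := (∀ A ∈ E.members, (a ∈ A ↔ b ∈ A)) ∨ ∀ A ∈ E.members, (a ∈ A ↔ b ∉ A)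
  iseqv :=
    { refl := fun a => Or.inl fun A _ => Iff.rfl
      symm := by
        rintro a b (h | h)
        · exact Or.inl fun A hA => (h A hA).symm
        · exact Or.inr fun A hA => by have := h A hA; tauto
      trans := by
        rintro a b c (h | h) (h' | h')
        · exact Or.inl fun A hA => (h A hA).trans (h' A hA)
        · exact Or.inr fun A hA => (h A hA).trans (h' A hA)
        · exact Or.inr fun A hA => by have := h A hA; have := h' A hA; tauto
        · exact Or.inl fun A hA => by have := h A hA; have := h' A hA; tauto }

/-- A clutter in which every element has a complementary one is a duplication of a cuboid. -/
theorem exists_isCuboid_hasDuplication {V : Type u} [Finite V] [Nonempty V] (E : Clutter V)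
    (hE : E.members.Nonempty) (hcompl : ∀ a, ∃ b, ∀ A ∈ E.members, (a ∈ A ↔ b ∉ A)) :
    ∃ (W : Type u) (D : Clutter W), D.IsCuboid ∧ D.HasDuplication E := by
  classical
  obtain ⟨A₀, hA₀⟩ := hE
  let Q := Quotient E.parallelSetoid
  let n := Nat.card Q
  let e : Q ≃ Fin n := Finite.equivFin Q
  -- The class is the coordinate; the reference member `A₀` decides which side of the pair is
  -- `true`.
  let f : V → Fin n × Bool := fun a => (e ⟦a⟧, decide (a ∈ A₀))
  have hf : f.Surjective := by
    rintro ⟨i, c⟩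
    obtain ⟨q, rfl⟩ := e.surjective i
    induction q using Quotient.inductionOn with | _ a
    by_cases hc : decide (a ∈ A₀) = c
    · exact ⟨a, by simp [f, hc]⟩
    · obtain ⟨b, hb⟩ := hcompl a
      refine ⟨b, Prod.ext (congrArg e (Quotient.sound ?_)) ?_⟩
      · exact E.parallelSetoid.symm (Or.inr hb)
      · have := hb A₀ hA₀
        cases c <;> simp_all [f]
  let S : Set (Fin n → Bool) := {p | ∃ A ∈ E.members, ∀ a, a ∈ A ↔ p (f a).1 = (f a).2}
  have hcub : E = (cuboid S).comap f hf := by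
    ext A
    constructor
    · intro hA
      -- Passing to a complementary element flips membership in both `A` and `A₀`, so their
      -- agreement depends only on the class.
      have hwd : ∀ a b, E.parallelSetoid a b →
          decide (a ∈ A ↔ a ∈ A₀) = decide (b ∈ A ↔ b ∈ A₀) := by
        rintro a b (h | h)
        · simp [h A hA, h A₀ hA₀]
        · simp [h A hA, h A₀ hA₀, not_iff_not]
      let p : Fin n → Bool := fun i =>
        Quotient.lift (fun a => decide (a ∈ A ↔ a ∈ A₀)) hwd (e.symm i)
      have hp : ∀ a, a ∈ A ↔ p (f a).1 = (f a).2 := fun a => by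
        have hpa : p (f a).1 = decide (a ∈ A ↔ a ∈ A₀) := by
          simp only [p, f, Equiv.symm_apply_apply]
          rfl
        rw [hpa]
        by_cases h : a ∈ A <;> by_cases h₀ : a ∈ A₀ <;> simp [f, h, h₀]
      exact ⟨_, ⟨p, ⟨A, hA, hp⟩, rfl⟩, fun a => by rw [hp]; simp⟩
    · rintro ⟨_, ⟨p, ⟨A', hA', hp⟩, rfl⟩, hA⟩
      have : A = A' := Finset.ext fun a => by rw [hA, hp]; simp
      exact this ▸ hA'
  -- `HasDuplication` keeps all ground sets in the universe `u`.
  have hg : (fun a => ULift.up.{u} (f a)).Surjective := ULift.up_surjective.comp hf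
  let D : Clutter (ULift.{u} (Fin n × Bool)) := (cuboid S).relabel Equiv.ulift.symm
  have hED : E = D.comap _ hg := by
    conv_lhs => rw [hcub]
    ext A
    constructor
    · rintro ⟨X, hX, hA⟩
      exact ⟨_, ⟨X, hX, rfl⟩, fun a => by rw [hA, Finset.mem_map_equiv]; rfl⟩
    · rintro ⟨_, ⟨X, hX, rfl⟩, hA⟩
      exact ⟨X, hX, fun a => by rw [hA, Finset.mem_map_equiv]; rfl⟩
  have hn : 1 ≤ n := by
    have : Nonempty Q := ⟨⟦Classical.arbitrary V⟧⟩
    exact Nat.card_pos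
  refine ⟨_, D, ⟨n, hn, S, Equiv.ulift, ?_⟩, hED ▸ hasDuplication_comap D _ hg⟩
  have hmap : ∀ X : Finset (Fin n × Bool), (X.map Equiv.ulift.{u}.symm.toEmbedding).map
      Equiv.ulift.{u}.toEmbedding = X := fun X => by
    ext q
    rw [Finset.mem_map_equiv, Finset.mem_map_equiv]
    rfl
  ext A
  constructor
  · rintro ⟨_, ⟨X, hX, rfl⟩, rfl⟩
    rwa [hmap]
  · intro hA
    exact ⟨_, ⟨A, hA, rfl⟩, (hmap A).symm⟩

end Clutter

theorem mainTheorem6 {V : Type u} [Fintype V] (C : Clutter V)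
    (hIdeal : C.IsIdeal) (hTangled : C.IsTangled) :
    (∃ (W : Type u) (D : Clutter W), D.IsCuboid ∧ D.HasDuplication C.core) ∧
      C.core.IsIdeal ∧ C.core.IsTangled := by
  refine ⟨?_, hIdeal.core hTangled, hTangled.core hIdeal⟩
  obtain ⟨B, hB⟩ := hTangled.exists_isMinimumCover
  obtain ⟨a, _⟩ := Finset.card_pos.1 (by rw [hTangled.card_eq_two hB]; norm_num : 0 < B.card)
  have : Nonempty V := ⟨a⟩
  refine C.core.exists_isCuboid_hasDuplication ?_ fun a => ?_
  -- Without members, `∅` would cover the core.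
  · by_contra hemp
    have := hTangled.two_le_card_of_isCover_core hIdeal (B := ∅) fun A hA => (hemp ⟨A, hA⟩).elim
    simp at this
  · obtain ⟨B, hB, ha⟩ := hTangled.2 a
    obtain ⟨b, _, _, h⟩ := hTangled.exists_pair hB ha
    exact ⟨b, h⟩
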